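/- Let $R$ be a commutative Noetherian semiperfect ring (equivalently, a finite direct product of commutative Noetherian local rings), and let $C$ be a semidualizing $R$-module, i.e. a finitely generated $R$-module such that the homothety map $R \to \operatorname{Hom}_R(C,C)$ is an isomorphism and $\operatorname{Ext}^i_R(C,C)=0$ for all $i>0$. A finitely generated $R$-module $X$ is totally $C$-reflexive if the biduality map $X \to \operatorname{Hom}_R(\operatorname{Hom}_R(X,C),C)$ is an isomorphism and $\operatorname{Ext}^i_R(X,C)=\operatorname{Ext}^i_R(\operatorname{Hom}_R(X,C),C)=0$ for all $i>0$. For a finitely generated $R$-module $M$, the $\mathrm{G}_C$-dimension $\mathrm{G}_C\text{-}\dim_R(M)\in\mathbb{N}\cup\{\infty\}$ is the least $n\ge 0$ for which there is an exact sequence $0\to X_n\to\cdots\to X_0\to M\to 0$ with all $X_i$ totally $C$-reflexive ($\infty$ if there is no such $n$), and the reduced grade of $M$ with respect to $C$ is $\operatorname{r.grade}_R(M,C)=\inf\{i>0 \mid \operatorname{Ext}^i_R(M,C)\ne 0\}$ (with $\inf\emptyset=\infty$). The module $M$ is reduced $\mathrm{G}_C$-perfect if $\mathrm{G}_C\text{-}\dim_R(M)<\infty$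 and $\operatorname{r.grade}_R(M,C)=\mathrm{G}_C\text{-}\dim_R(M)$. A transpose $\operatorname{Tr}_C(M)$ of $M$ with respect to $C$ is the cokernel of $\operatorname{Hom}_R(f,C)\colon \operatorname{Hom}_R(P_0,C)\to\operatorname{Hom}_R(P_1,C)$, where $P_1\xrightarrow{f}P_0\to M\to 0$ is a presentation of $M$ by finitely generated projective $R$-modules. **Theorem.** Let $M$ be a reduced $\mathrm{G}_C$-perfect $R$-module of $\mathrm{G}_C$-dimension $n$. Then, for every choice of the transpose $\operatorname{Tr}_C(M)$, $$\mathrm{G}_C\text{-}\dim_R(M)+\mathrm{G}_C\text{-}\dim_R(\operatorname{Tr}_C(M))=\mathrm{G}_C\text{-}\dim_R(\operatorname{Ext}^n_R(M,C))+1$$ as an equality in $\mathbb{N}\cup\{\infty\}$; in particular, one side is infinite exactly when the other is. -/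

import Mathlib

open CategoryTheory

universe u

/-- A commutative ring is semiperfect if it is semisimple modulo its Jacobson radical and
idempotents lift modulo the Jacobson radical. -/
def IsSemiperfectRing (R : Type u) [CommRing R] : Prop :=
  IsSemisimpleRing (R ⧸ Ring.jacobson R) ∧
    ∀ e : R ⧸ Ring.jacobson R, IsIdempotentElem e →
      ∃ a : R, IsIdempotentElem a ∧ Ideal.Quotient.mk (Ring.jacobson R) a = e

/-- `Ext^i_R(M, N)`, with its structure of an `R`-module. -/
abbrev ModExt (R : Type u) [CommRing R] (M N : Type u) [AddCommGroup M] [Module R M]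
    [AddCommGroup N] [Module R N] (i : ℕ) : Type u :=
  Abelian.Ext.{u} (ModuleCat.of R M) (ModuleCat.of R N) i

/-- `C` is a semidualizing `R`-module. -/
structure IsSemidualizing (R : Type u) [CommRing R] (C : Type u) [AddCommGroup C] [Module R C] :
    Prop where
  finite : Module.Finite R C
  homothety_bijective : Function.Bijective (LinearMap.lsmul R C : R →ₗ[R] C →ₗ[R] C)
  ext_eq_zero : ∀ i : ℕ, 0 < i → Subsingleton (ModExt R C C i)

/-- The biduality map `M → Hom_R(Hom_R(M, C), C)`, sending `x` to `f ↦ f x`. -/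
def biduality (R : Type u) [CommRing R] (C M : Type u) [AddCommGroup C] [Module R C]
    [AddCommGroup M] [Module R M] : M →ₗ[R] (M →ₗ[R] C) →ₗ[R] C :=
  (LinearMap.id : (M →ₗ[R] C) →ₗ[R] (M →ₗ[R] C)).flip

/-- The `R`-module `M` is (finite and) totally `C`-reflexive. -/
structure IsTotallyReflexive (R : Type u) [CommRing R] (C M : Type u) [AddCommGroup C]
    [Module R C] [AddCommGroup M] [Module R M] : Prop where
  finite : Module.Finite R M
  biduality_bijective : Function.Bijective (biduality R C M)
  ext_eq_zero : ∀ i : ℕ, 0 < i → Subsingleton (ModExt R M C i)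
  ext_dual_eq_zero : ∀ i : ℕ, 0 < i → Subsingleton (ModExt R (M →ₗ[R] C) C i)

/-- A `G_C`-resolution `⋯ → X 2 → X 1 → X 0 → M → 0` of the `R`-module `M`. -/
structure GCResolution (R : Type u) [CommRing R] (C M : Type u) [AddCommGroup C]
    [Module R C] [AddCommGroup M] [Module R M] where
  X : ℕ → ModuleCat.{u} R
  d : ∀ i, X (i + 1) →ₗ[R] X i
  ε : X 0 →ₗ[R] M
  totallyReflexive : ∀ i, IsTotallyReflexive R C (X i)
  surjective : Function.Surjective ε
  exact_zero : Function.Exact (d 0) ε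
  exact_succ : ∀ i, Function.Exact (d (i + 1)) (d i)

/-- `M` has a `G_C`-resolution `0 → X n → ⋯ → X 0 → M → 0`, that is, one that vanishes in all
degrees above `n`. -/
def HasGCResolutionOfLength (R : Type u) [CommRing R] (C M : Type u) [AddCommGroup C]
    [Module R C] [AddCommGroup M] [Module R M] (n : ℕ) : Prop :=
  ∃ res : GCResolution R C M, ∀ i, n < i → Subsingleton (res.X i)

/-- The `G_C`-dimension of `M`; it is `⊤` if there is no `G_C`-resolution of finite length. -/
noncomputable def GCdim (R : Type u) [CommRing R] (C M : Type u) [AddCommGroup C]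
    [Module R C] [AddCommGroup M] [Module R M] : ℕ∞ :=
  ⨅ (n : ℕ) (_ : HasGCResolutionOfLength R C M n), (n : ℕ∞)

/-- The reduced grade `inf {i > 0 | Ext^i_R(M, C) ≠ 0}` of `M` with respect to `C`; it is `⊤` if
there is no such `i`. -/
noncomputable def reducedGrade (R : Type u) [CommRing R] (C M : Type u) [AddCommGroup C]
    [Module R C] [AddCommGroup M] [Module R M] : ℕ∞ :=
  ⨅ (i : ℕ) (_ : 0 < i ∧ Nontrivial (ModExt R M C i)), (i : ℕ∞)

/-- `M` is reduced `G_C`-perfect: it is finite, of finite `G_C`-dimension, and its `G_C`-dimension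
is equal to its reduced grade with respect to `C`. -/
structure IsReducedGCPerfect (R : Type u) [CommRing R] (C M : Type u) [AddCommGroup C]
    [Module R C] [AddCommGroup M] [Module R M] : Prop where
  finite : Module.Finite R M
  gcdim_ne_top : GCdim R C M ≠ ⊤
  reducedGrade_eq : reducedGrade R C M = GCdim R C M

/-- `P₁ --f--> P₀ --g--> M → 0` is a presentation of `M` by finite projective modules. -/
structure IsProjectivePresentation {R : Type u} [CommRing R] {P₁ P₀ M : Type u}
    [AddCommGroup P₁] [Module R P₁] [AddCommGroup P₀] [Module R P₀] [AddCommGroup M] [Module R M]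
    (f : P₁ →ₗ[R] P₀) (g : P₀ →ₗ[R] M) : Prop where
  finite_one : Module.Finite R P₁
  finite_zero : Module.Finite R P₀
  projective_one : Module.Projective R P₁
  projective_zero : Module.Projective R P₀
  exact : Function.Exact f g
  surjective : Function.Surjective g

/-- The transpose with respect to `C` obtained from a projective presentation with first map
`f : P₁ → P₀`: the cokernel of `Hom_R(f, C) : Hom_R(P₀, C) → Hom_R(P₁, C)`. -/
abbrev TrC {R : Type u} [CommRing R] (C : Type u) [AddCommGroup C] [Module R C] {P₁ P₀ : Type u}
    [AddCommGroup P₁] [Module R P₁] [AddCommGroup P₀] [Module R P₀] (f : P₁ →ₗ[R] P₀) : Type u :=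
  (P₁ →ₗ[R] C) ⧸ LinearMap.range (LinearMap.lcomp R C f)

/-! Write X^† for Hom(X, C), L = ker g for the first syzygy of M, and N for the kernel of P₁ → L.
The proof is an induction on n ≥ 1 along syzygies.

For n = 1 the modules L and N are totally reflexive. The map L^† → P₁^† → Tr M kills exactly the
functionals on L that extend to P₀, so it has the same kernel as the connecting surjection L^† →
Ext^1(M, C). This gives a short exact sequence 0 → Ext^1(M, C) → Tr M → N^† → 0. Its last term is
totally reflexive, so the first two have equal dimension (`GCdim_ext_one_eq`).

For n > 1 the vanishing of Ext^1(M, C) gives 0 → Tr M → P₂^† → Tr L → 0 (`exists_isShortExact_TrC`).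
Passing from M to L thus lowers the dimension of the module by one and raises that of the transpose
by one, while Ext^n(M, C) ≅ Ext^{n-1}(L, C). The raise by one could only fail if Tr L were totally
reflexive; then L would be too (`isTotallyReflexive_of_TrC`), which its positive dimension forbids.

These dimension counts rest on `GCdimLE.succ_iff`: any totally reflexive module mapping onto a
module computes its dimension. -/

/-- The sequence `0 → A --i--> B --p--> D → 0` is exact. -/
structure IsShortExact {R : Type u} [CommRing R] {A B D : Type u} [AddCommGroup A] [Module R A]
    [AddCommGroup B] [Module R B] [AddCommGroup D] [Module R D] (i : A →ₗ[R] B) (p : B →ₗ[R] D) :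
    Prop where
  injective : Function.Injective i
  exact : Function.Exact i p
  surjective : Function.Surjective p

theorem isShortExact_ker_subtype {R : Type u} [CommRing R] {B D : Type u} [AddCommGroup B]
    [Module R B] [AddCommGroup D] [Module R D] {p : B →ₗ[R] D} (hp : Function.Surjective p) :
    IsShortExact (LinearMap.ker p).subtype p :=
  ⟨Subtype.val_injective, LinearMap.exact_subtype_ker_map p, hp⟩

/-! ### The contravariant long exact sequence of Ext. -/

section Ext

variable {R : Type u} [CommRing R] {A B D C : Type u} [AddCommGroup A] [Module R A]
  [AddCommGroup B] [Module R B] [AddCommGroup D] [Module R D] [AddCommGroup C] [Module R C]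

namespace ModExt

/-- The map induced on `Ext^i_R(-, C)` by a linear map. -/
noncomputable def map (C : Type u) [AddCommGroup C] [Module R C] (i : ℕ) (f : A →ₗ[R] B) :
    ModExt R B C i →ₗ[R] ModExt R A C i :=
  (Abelian.Ext.mk₀ (ModuleCat.ofHom f)).precompOfLinear R (ModuleCat.of R C) (zero_add i)

theorem map_id_apply (i : ℕ) (x : ModExt R A C i) : map C i (LinearMap.id : A →ₗ[R] A) x = x :=
  Abelian.Ext.mk₀_id_comp x

theorem map_comp_apply (i : ℕ) (f : A →ₗ[R] B) (g : B →ₗ[R] D) (x : ModExt R D C i) :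
    map C i (g ∘ₗ f) x = map C i f (map C i g x) := by
  simp only [map, Abelian.Ext.bilinearCompOfLinear_apply_apply, Abelian.Ext.mk₀_comp_mk₀_assoc]
  rfl

theorem subsingleton_of_retract {i : ℕ} (s : A →ₗ[R] B) (r : B →ₗ[R] A)
    (h : r ∘ₗ s = LinearMap.id) [Subsingleton (ModExt R B C i)] :
    Subsingleton (ModExt R A C i) := by
  refine subsingleton_of_forall_eq 0 fun x => ?_
  rw [← map_id_apply i x, ← h, map_comp_apply, Subsingleton.elim (map C i r x) 0, map_zero]

theorem subsingleton_of_equiv {i : ℕ} (e : A ≃ₗ[R] B) [Subsingleton (ModExt R B C i)] :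
    Subsingleton (ModExt R A C i) :=
  subsingleton_of_retract e.toLinearMap e.symm.toLinearMap (by ext; simp)

theorem subsingleton_of_projective [Module.Projective R A] {i : ℕ} (hi : 0 < i) :
    Subsingleton (ModExt R A C i) := by
  obtain ⟨i, rfl⟩ := Nat.exists_eq_add_of_lt hi
  rw [zero_add]
  have : Projective (ModuleCat.of R A) := (IsProjective.iff_projective A).1 inferInstance
  exact Abelian.Ext.subsingleton_of_projective _ _ _

end ModExt

namespace IsShortExact

variable {i : A →ₗ[R] B} {p : B →ₗ[R] D} (h : IsShortExact i p)
include h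

theorem comp_eq_zero : p ∘ₗ i = 0 := h.exact.linearMap_comp_eq_zero

theorem apply_apply (a : A) : p (i a) = 0 := h.exact.apply_apply_eq_zero a

omit h in
/-- The short complex of modules attached to a short exact sequence. -/
abbrev shortComplex (h : IsShortExact i p) : ShortComplex (ModuleCat.{u} R) :=
  ShortComplex.moduleCatMk i p h.comp_eq_zero

theorem shortExact : h.shortComplex.ShortExact :=
  ModuleCat.shortComplex_shortExact _ h.exact h.injective h.surjective

/-- The connecting map `Ext^n_R(A, C) → Ext^{n+1}_R(D, C)`. -/
noncomputable def connecting (C : Type u) [AddCommGroup C] [Module R C] (n : ℕ) :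
    ModExt R A C n →ₗ[R] ModExt R D C (n + 1) :=
  h.shortExact.extClass.precompOfLinear R (ModuleCat.of R C) (add_comm 1 n)

theorem exact_ext_mid (n : ℕ) : Function.Exact (ModExt.map C n p) (ModExt.map C n i) := by
  intro x
  refine ⟨fun hx => Abelian.Ext.contravariant_sequence_exact₂ h.shortExact _ x hx, ?_⟩
  rintro ⟨y, rfl⟩
  rw [← ModExt.map_comp_apply, h.comp_eq_zero, ModExt.map]
  simp

theorem exact_ext_left (n : ℕ) :
    Function.Exact (ModExt.map C n i) (h.connecting C n) := by
  intro x
  refine ⟨fun hx => Abelian.Ext.contravariant_sequence_exact₁ h.shortExact _ x (add_comm 1 n) hx, ?_⟩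
  rintro ⟨y, rfl⟩
  exact h.shortExact.extClass_comp_assoc (n' := n + 1) (h := add_comm 1 n) y

theorem exact_ext_right (n : ℕ) :
    Function.Exact (h.connecting C n) (ModExt.map C (n + 1) p) := by
  intro x
  refine ⟨fun hx => Abelian.Ext.contravariant_sequence_exact₃ h.shortExact _ x hx (add_comm 1 n), ?_⟩
  rintro ⟨y, rfl⟩
  exact h.shortExact.comp_extClass_assoc y (add_comm 1 n)

theorem subsingleton_ext_mid {n : ℕ} [Subsingleton (ModExt R A C n)]
    [Subsingleton (ModExt R D C n)] : Subsingleton (ModExt R B C n) := by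
  refine subsingleton_of_forall_eq 0 fun x => ?_
  obtain ⟨y, rfl⟩ := (h.exact_ext_mid n x).1 (Subsingleton.elim _ _)
  rw [Subsingleton.elim y 0, map_zero]

theorem subsingleton_ext_left {n : ℕ} [Subsingleton (ModExt R B C n)]
    [Subsingleton (ModExt R D C (n + 1))] : Subsingleton (ModExt R A C n) := by
  refine subsingleton_of_forall_eq 0 fun x => ?_
  obtain ⟨y, rfl⟩ := (h.exact_ext_left n x).1 (Subsingleton.elim _ _)
  rw [Subsingleton.elim y 0, map_zero]

theorem subsingleton_ext_right {n : ℕ} [Subsingleton (ModExt R A C n)]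
    [Subsingleton (ModExt R B C (n + 1))] : Subsingleton (ModExt R D C (n + 1)) := by
  refine subsingleton_of_forall_eq 0 fun x => ?_
  obtain ⟨y, rfl⟩ := (h.exact_ext_right n x).1 (Subsingleton.elim _ _)
  rw [Subsingleton.elim y 0, map_zero]

theorem connecting_bijective {n : ℕ} [Subsingleton (ModExt R B C n)]
    [Subsingleton (ModExt R B C (n + 1))] : Function.Bijective (h.connecting C n) := by
  constructor
  · rw [injective_iff_map_eq_zero]
    intro x hx
    obtain ⟨y, rfl⟩ := (h.exact_ext_left n x).1 hx
    rw [Subsingleton.elim y 0, map_zero]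
  · exact fun x => (h.exact_ext_right n x).1 (Subsingleton.elim _ _)

omit h in
/-- The identification of `Hom_R(A, C)` with `Ext^0_R(A, C)`. -/
noncomputable def _root_.ModExt.zeroEquiv (R A C : Type u) [CommRing R] [AddCommGroup A]
    [Module R A] [AddCommGroup C] [Module R C] : (A →ₗ[R] C) ≃ₗ[R] ModExt R A C 0 :=
  (ModuleCat.homLinearEquiv (S := R) (M := ModuleCat.of R A) (N := ModuleCat.of R C)).symm.trans
    (Abelian.Ext.linearEquiv₀ (R := R)).symm

omit h in
theorem _root_.ModExt.map_zeroEquiv (f : A →ₗ[R] B) (φ : B →ₗ[R] C) :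
    ModExt.map C 0 f (ModExt.zeroEquiv R B C φ) = ModExt.zeroEquiv R A C (φ ∘ₗ f) :=
  Abelian.Ext.mk₀_comp_mk₀ (ModuleCat.ofHom f) (ModuleCat.ofHom φ)

/-- The connecting map `Hom_R(A, C) → Ext^1_R(D, C)`. -/
noncomputable def homConnecting (C : Type u) [AddCommGroup C] [Module R C] :
    (A →ₗ[R] C) →ₗ[R] ModExt R D C 1 :=
  h.connecting C 0 ∘ₗ (ModExt.zeroEquiv R A C).toLinearMap

theorem exact_homConnecting : Function.Exact (LinearMap.lcomp R C i) (h.homConnecting C) := by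
  intro φ
  refine (h.exact_ext_left 0 _).trans ⟨?_, ?_⟩
  · rintro ⟨y, hy⟩
    obtain ⟨ψ, rfl⟩ := (ModExt.zeroEquiv R B C).surjective y
    rw [ModExt.map_zeroEquiv] at hy
    exact ⟨ψ, (ModExt.zeroEquiv R A C).injective hy⟩
  · rintro ⟨ψ, rfl⟩
    exact ⟨ModExt.zeroEquiv R B C ψ, ModExt.map_zeroEquiv _ _⟩

theorem exact_homConnecting_map :
    Function.Exact (h.homConnecting C) (ModExt.map C 1 p) := by
  intro x
  refine (h.exact_ext_right 0 x).trans ⟨?_, ?_⟩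
  · rintro ⟨y, rfl⟩
    exact ⟨(ModExt.zeroEquiv R A C).symm y, by simp [homConnecting]⟩
  · rintro ⟨y, rfl⟩
    exact ⟨_, rfl⟩

theorem lcomp_surjective [Subsingleton (ModExt R D C 1)] :
    Function.Surjective (LinearMap.lcomp R C i) :=
  fun φ => (h.exact_homConnecting φ).1 (Subsingleton.elim _ _)

theorem homConnecting_surjective [Subsingleton (ModExt R B C 1)] :
    Function.Surjective (h.homConnecting C) :=
  fun x => (h.exact_homConnecting_map x).1 (Subsingleton.elim _ _)

theorem subsingleton_ext_one [Subsingleton (ModExt R B C 1)]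
    (hs : Function.Surjective (LinearMap.lcomp R C i)) : Subsingleton (ModExt R D C 1) := by
  refine subsingleton_of_forall_eq 0 fun x => ?_
  obtain ⟨φ, rfl⟩ := h.homConnecting_surjective x
  exact (h.exact_homConnecting φ).2 (hs φ)

theorem lcomp_injective : Function.Injective (LinearMap.lcomp R C p) := by
  intro φ ψ hφ
  ext d
  obtain ⟨b, rfl⟩ := h.surjective d
  exact LinearMap.congr_fun hφ b

theorem lcomp_exact : Function.Exact (LinearMap.lcomp R C p) (LinearMap.lcomp R C i) :=
  LinearMap.exact_lcomp_of_exact_of_surjective C h.exact h.surjective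

theorem dual [Subsingleton (ModExt R D C 1)] :
    IsShortExact (LinearMap.lcomp R C p) (LinearMap.lcomp R C i) :=
  ⟨h.lcomp_injective, h.lcomp_exact, h.lcomp_surjective⟩

end IsShortExact

end Ext

/-! ### Diagram chases and finiteness for short exact sequences. -/

section ShortExact

variable {R : Type u} [CommRing R] {A B D A' B' D' : Type u} [AddCommGroup A] [Module R A]
  [AddCommGroup B] [Module R B] [AddCommGroup D] [Module R D] [AddCommGroup A'] [Module R A']
  [AddCommGroup B'] [Module R B'] [AddCommGroup D'] [Module R D']

namespace IsShortExact

variable {i : A →ₗ[R] B} {p : B →ₗ[R] D} {i' : A' →ₗ[R] B'} {p' : B' →ₗ[R] D'}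

theorem bijective_left (h : IsShortExact i p) (h' : IsShortExact i' p') {a : A →ₗ[R] A'}
    {b : B →ₗ[R] B'} {d : D →ₗ[R] D'} (hl : ∀ x, b (i x) = i' (a x))
    (hr : ∀ x, d (p x) = p' (b x)) (hb : Function.Bijective b) (hd : Function.Bijective d) :
    Function.Bijective a := by
  refine ⟨fun x y hxy => h.injective (hb.1 (by rw [hl, hl, hxy])), fun y => ?_⟩
  obtain ⟨z, hz⟩ := hb.2 (i' y)
  have hpz : p z = 0 := hd.1 (by rw [hr, hz, h'.apply_apply, map_zero])
  obtain ⟨x, rfl⟩ := (h.exact z).1 hpz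
  exact ⟨x, h'.injective (by rw [← hl, hz])⟩

theorem bijective_mid (h : IsShortExact i p) (h' : IsShortExact i' p') {a : A →ₗ[R] A'}
    {b : B →ₗ[R] B'} {d : D →ₗ[R] D'} (hl : ∀ x, b (i x) = i' (a x))
    (hr : ∀ x, d (p x) = p' (b x)) (ha : Function.Bijective a) (hd : Function.Bijective d) :
    Function.Bijective b := by
  constructor
  · rw [injective_iff_map_eq_zero]
    intro x hx
    have hpx : p x = 0 := hd.1 (by rw [hr, hx, map_zero, map_zero])
    obtain ⟨y, rfl⟩ := (h.exact x).1 hpx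
    have hy : y = 0 := ha.1 (h'.injective (by rw [← hl, hx, map_zero, map_zero]))
    rw [hy, map_zero]
  · intro y
    obtain ⟨z, hz⟩ := hd.2 (p' y)
    obtain ⟨x, rfl⟩ := h.surjective z
    obtain ⟨w, hw⟩ := (h'.exact (y - b x)).1 (by rw [map_sub, ← hz, hr, sub_self])
    obtain ⟨v, rfl⟩ := ha.2 w
    exact ⟨i v + x, by rw [map_add, hl, hw, sub_add_cancel]⟩

theorem finite_left [IsNoetherianRing R] (h : IsShortExact i p) [Module.Finite R B] :
    Module.Finite R A :=
  Module.Finite.of_injective i h.injective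

theorem finite_mid [IsNoetherianRing R] (h : IsShortExact i p) [Module.Finite R A]
    [Module.Finite R D] : Module.Finite R B :=
  have := isNoetherian_of_range_eq_ker i p h.exact.linearMap_ker_eq.symm
  inferInstance

end IsShortExact

end ShortExact

/-! ### Closure properties of totally reflexive modules. -/

section TotallyReflexive

variable {R : Type u} [CommRing R] {A B D C : Type u} [AddCommGroup A] [Module R A]
  [AddCommGroup B] [Module R B] [AddCommGroup D] [Module R D] [AddCommGroup C] [Module R C]

theorem biduality_apply_map (f : A →ₗ[R] B) (x : A) :
    biduality R C B (f x) =
      LinearMap.lcomp R C (LinearMap.lcomp R C f) (biduality R C A x) := rfl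

namespace IsTotallyReflexive

theorem of_retract (hB : IsTotallyReflexive R C B) (s : A →ₗ[R] B) (r : B →ₗ[R] A)
    (h : r ∘ₗ s = LinearMap.id) : IsTotallyReflexive R C A := by
  have hrs (x : A) : r (s x) = x := LinearMap.congr_fun h x
  have hrs' : LinearMap.lcomp R C s ∘ₗ LinearMap.lcomp R C r = LinearMap.id := by
    ext φ x
    exact congrArg φ (hrs x)
  have := hB.finite
  refine ⟨Module.Finite.of_surjective r fun x => ⟨s x, hrs x⟩, ⟨?_, fun φ => ?_⟩, fun n hn => ?_,
    fun n hn => ?_⟩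
  · rw [injective_iff_map_eq_zero]
    intro x hx
    have hs : s x = 0 := hB.biduality_bijective.1 (by
      rw [biduality_apply_map, hx, map_zero, map_zero])
    rw [← hrs x, hs, map_zero]
  · obtain ⟨b, hb⟩ :=
      hB.biduality_bijective.2 (LinearMap.lcomp R C (LinearMap.lcomp R C s) φ)
    refine ⟨r b, ?_⟩
    rw [biduality_apply_map, hb]
    ext ψ
    exact congrArg φ (LinearMap.congr_fun hrs' ψ)
  · have := hB.ext_eq_zero n hn
    exact ModExt.subsingleton_of_retract s r h
  · have := hB.ext_dual_eq_zero n hn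
    exact ModExt.subsingleton_of_retract _ _ hrs'

theorem of_equiv (hB : IsTotallyReflexive R C B) (e : A ≃ₗ[R] B) : IsTotallyReflexive R C A :=
  hB.of_retract e.toLinearMap e.symm.toLinearMap (by ext; simp)

variable {i : A →ₗ[R] B} {p : B →ₗ[R] D}

/-- The biduality maps send the sequence to its double dual, so two isomorphisms force the third.
The double dual is exact because Ext^1(A^†, C) = 0, which is itself a consequence of the biduality
of D. -/
theorem left [IsNoetherianRing R] (h : IsShortExact i p) (hB : IsTotallyReflexive R C B)
    (hD : IsTotallyReflexive R C D) : IsTotallyReflexive R C A := by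
  have := hB.finite
  have := hD.ext_eq_zero 1 one_pos
  have := hB.ext_dual_eq_zero 1 one_pos
  -- Up to biduality of D this is the surjection B → D, so every functional on D^† already comes
  -- from B.
  have hs : Function.Surjective (LinearMap.lcomp R C (LinearMap.lcomp R C p)) := by
    intro φ
    obtain ⟨d, rfl⟩ := hD.biduality_bijective.2 φ
    obtain ⟨b, rfl⟩ := h.surjective d
    exact ⟨biduality R C B b, rfl⟩
  have hA := (h.dual (C := C)).subsingleton_ext_one hs
  refine ⟨h.finite_left, h.bijective_left (h.dual (C := C)).dual (biduality_apply_map i)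
    (biduality_apply_map p) hB.biduality_bijective hD.biduality_bijective, fun n hn => ?_,
    fun n hn => ?_⟩
  · have := hB.ext_eq_zero n hn
    have := hD.ext_eq_zero (n + 1) n.succ_pos
    exact h.subsingleton_ext_left
  · obtain _ | _ | n := n
    · exact absurd hn (lt_irrefl 0)
    · exact hA
    · have := hD.ext_dual_eq_zero (n + 1) n.succ_pos
      have := hB.ext_dual_eq_zero (n + 2) hn
      exact (h.dual (C := C)).subsingleton_ext_right

theorem mid [IsNoetherianRing R] (h : IsShortExact i p) (hA : IsTotallyReflexive R C A)
    (hD : IsTotallyReflexive R C D) : IsTotallyReflexive R C B := by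
  have := hA.finite
  have := hD.finite
  have := hD.ext_eq_zero 1 one_pos
  have := hA.ext_dual_eq_zero 1 one_pos
  refine ⟨h.finite_mid, h.bijective_mid (h.dual (C := C)).dual (biduality_apply_map i)
    (biduality_apply_map p) hA.biduality_bijective hD.biduality_bijective, fun n hn => ?_,
    fun n hn => ?_⟩
  · have := hA.ext_eq_zero n hn
    have := hD.ext_eq_zero n hn
    exact h.subsingleton_ext_mid
  · have := hA.ext_dual_eq_zero n hn
    have := hD.ext_dual_eq_zero n hn
    exact (h.dual (C := C)).subsingleton_ext_mid

theorem prod [IsNoetherianRing R] (hA : IsTotallyReflexive R C A)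
    (hB : IsTotallyReflexive R C B) : IsTotallyReflexive R C (A × B) :=
  mid (i := LinearMap.inl R A B) (p := LinearMap.snd R A B)
    ⟨LinearMap.inl_injective, Function.Exact.inl_snd, LinearMap.snd_surjective⟩ hA hB

/-- By the triangle identity the biduality map of A^† is a section of the dual of the biduality map
of A. That dual is injective, so the section is bijective. -/
theorem dual [IsNoetherianRing R] (hC : IsSemidualizing R C) (hA : IsTotallyReflexive R C A) :
    IsTotallyReflexive R C (A →ₗ[R] C) := by
  have := hC.finite
  have := hA.finite
  have hinj : Function.Injective (LinearMap.lcomp R C (biduality R C A)) :=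
    LinearMap.lcomp_injective_of_surjective _ hA.biduality_bijective.2
  have hleft : Function.LeftInverse (LinearMap.lcomp R C (biduality R C A))
      (biduality R C (A →ₗ[R] C)) := fun _ => rfl
  refine ⟨inferInstance, ⟨hleft.injective, fun ψ => ⟨_, hinj (hleft _)⟩⟩, hA.ext_dual_eq_zero,
    fun n hn => ?_⟩
  have := hA.ext_eq_zero n hn
  exact ModExt.subsingleton_of_equiv (LinearEquiv.ofBijective _ hA.biduality_bijective).symm

/-- Under R^† ≅ C the biduality map of R becomes the homothety map of C, so the conditions on R are
those defining a semidualizing module. -/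
theorem self (hC : IsSemidualizing R C) : IsTotallyReflexive R C R := by
  let e : (R →ₗ[R] C) ≃ₗ[R] C := LinearMap.ringLmapEquivSelf R R C
  refine ⟨inferInstance, ⟨fun r s hrs => hC.homothety_bijective.1 ?_, fun φ => ?_⟩,
    fun n hn => ModExt.subsingleton_of_projective hn, fun n hn => ?_⟩
  · ext c
    simpa [e, biduality] using LinearMap.congr_fun hrs (e.symm c)
  · obtain ⟨r, hr⟩ := hC.homothety_bijective.2 (φ ∘ₗ e.symm.toLinearMap)
    refine ⟨r, ?_⟩
    ext ψ
    have := LinearMap.congr_fun hr (e ψ)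
    simp only [LinearMap.coe_comp, LinearEquiv.coe_coe, Function.comp_apply,
      LinearEquiv.symm_apply_apply] at this
    rw [← this]
    simp [biduality, e, ← map_smul]
  · have := hC.ext_eq_zero n hn
    exact ModExt.subsingleton_of_equiv e

theorem of_subsingleton (hC : IsSemidualizing R C) [Subsingleton A] : IsTotallyReflexive R C A :=
  (self hC).of_retract 0 0 (by ext x; exact Subsingleton.elim _ _)

theorem pi_fin [IsNoetherianRing R] (hC : IsSemidualizing R C) (k : ℕ) :
    IsTotallyReflexive R C (Fin k → R) := by
  induction k with
  | zero => exact of_subsingleton hC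
  | succ k ih => exact ((self hC).prod ih).of_equiv (Fin.consLinearEquiv R fun _ => R).symm

theorem of_projective [IsNoetherianRing R] (hC : IsSemidualizing R C) [Module.Finite R A]
    [Module.Projective R A] : IsTotallyReflexive R C A := by
  obtain ⟨k, r, hr⟩ := Module.Finite.exists_fin' R A
  obtain ⟨s, hs⟩ := Module.projective_lifting_property r LinearMap.id hr
  exact (pi_fin hC k).of_retract s r hs

end IsTotallyReflexive

end TotallyReflexive

/-! ### Bounds on the dimension, and short exact sequences. -/

/-- The `G_C`-dimension of `M` is at most `n`, by recursion on `n`. -/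
def GCdimLE (R : Type u) [CommRing R] (C : Type u) [AddCommGroup C] [Module R C] :
    ℕ → ∀ (M : Type u) [AddCommGroup M] [Module R M], Prop
  | 0, M, _, _ => IsTotallyReflexive R C M
  | n + 1, M, _, _ => ∃ (X : ModuleCat.{u} R) (p : X →ₗ[R] M), IsTotallyReflexive R C X ∧
      Function.Surjective p ∧ GCdimLE R C n (LinearMap.ker p)

section

variable {R : Type u} [CommRing R] {A B D C : Type u} [AddCommGroup A] [Module R A]
  [AddCommGroup B] [Module R B] [AddCommGroup D] [Module R D] [AddCommGroup C] [Module R C]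

namespace IsShortExact

variable {i : A →ₗ[R] B} {p : B →ₗ[R] D}

/-- The first term of a short exact sequence is the kernel of the second map. -/
noncomputable def equivKer (h : IsShortExact i p) : A ≃ₗ[R] LinearMap.ker p :=
  (LinearEquiv.ofInjective i h.injective).trans (LinearEquiv.ofEq _ _ h.exact.linearMap_ker_eq.symm)

theorem exists_lift (h : IsShortExact i p) {X : Type u} [AddCommGroup X] [Module R X]
    (f : X →ₗ[R] B) (hf : ∀ x, p (f x) = 0) : ∃ g : X →ₗ[R] A, ∀ x, i (g x) = f x := by
  refine ⟨h.equivKer.symm.toLinearMap ∘ₗ f.codRestrict (LinearMap.ker p) hf, fun x => ?_⟩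
  exact congrArg Subtype.val (h.equivKer.apply_symm_apply (f.codRestrict (LinearMap.ker p) hf x))

end IsShortExact

namespace GCdimLE

variable {n : ℕ}

theorem of_equiv (hB : GCdimLE R C n B) (e : A ≃ₗ[R] B) : GCdimLE R C n A := by
  induction n generalizing A B with
  | zero => exact IsTotallyReflexive.of_equiv hB e
  | succ n ih =>
    obtain ⟨X, p, hX, hp, hK⟩ := hB
    refine ⟨X, e.symm.toLinearMap ∘ₗ p, hX, e.symm.surjective.comp hp, ih hK ?_⟩
    exact LinearEquiv.ofEq _ _ (LinearEquiv.ker_comp e.symm p)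

variable {i : A →ₗ[R] B} {p : B →ₗ[R] D}

theorem of_isShortExact (h : IsShortExact i p) (hB : IsTotallyReflexive R C B)
    (hA : GCdimLE R C n A) : GCdimLE R C (n + 1) D :=
  ⟨ModuleCat.of R B, p, hB, h.surjective, hA.of_equiv h.equivKer.symm⟩

/-- A horseshoe argument: a totally reflexive cover X → A and a free cover of D, lifted to B,
combine to a cover of B. Its kernel is an extension of ker r, again totally reflexive, by ker q, so
the induction applies. -/
theorem mid [IsNoetherianRing R] (hC : IsSemidualizing R C) (h : IsShortExact i p)
    (hD : IsTotallyReflexive R C D) (hA : GCdimLE R C n A) : GCdimLE R C n B := by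
  induction n generalizing A B D with
  | zero => exact IsTotallyReflexive.mid h hA hD
  | succ n ih =>
    obtain ⟨X, q, hX, hq, hK⟩ := hA
    have := hD.finite
    obtain ⟨k, r, hr⟩ := Module.Finite.exists_fin' R D
    obtain ⟨t, ht⟩ := Module.projective_lifting_property p r h.surjective
    have ht' (y) : p (t y) = r y := LinearMap.congr_fun ht y
    let q' : X × (Fin k → R) →ₗ[R] B := (i ∘ₗ q).coprod t
    have hq'_apply (z) : q' z = i (q z.1) + t z.2 := rfl
    have hq' : Function.Surjective q' := by
      intro b
      obtain ⟨y, hy⟩ := hr (p b)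
      obtain ⟨a, ha⟩ := (h.exact (b - t y)).1 (by rw [map_sub, ht', hy, sub_self])
      obtain ⟨x, rfl⟩ := hq a
      exact ⟨(x, y), by rw [hq'_apply, ha, sub_add_cancel]⟩
    let j : LinearMap.ker q →ₗ[R] LinearMap.ker q' :=
      (LinearMap.inl R X (Fin k → R)).restrict fun x hx => by
        rw [LinearMap.mem_ker] at hx
        simp [q', hx]
    let s : LinearMap.ker q' →ₗ[R] LinearMap.ker r :=
      (LinearMap.snd R X (Fin k → R)).restrict fun x hx => by
        rw [LinearMap.mem_ker, hq'_apply] at hx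
        have := congrArg p hx
        rwa [map_add, h.apply_apply, zero_add, ht', map_zero] at this
    have hjs : IsShortExact j s := by
      refine ⟨fun x y hxy => ?_, fun z => ⟨fun hz => ?_, ?_⟩, fun y => ?_⟩
      · exact Subtype.ext (congrArg (fun z : LinearMap.ker q' => z.1.1) hxy)
      · obtain ⟨⟨x, y⟩, hxy⟩ := z
        obtain rfl : y = 0 := congrArg Subtype.val hz
        have hx : q x = 0 := h.injective (by simpa [q'] using hxy)
        exact ⟨⟨x, hx⟩, rfl⟩
      · rintro ⟨x, rfl⟩
        rfl
      · obtain ⟨a, ha⟩ := (h.exact (t y.1)).1 ((ht' _).trans y.2)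
        obtain ⟨x, rfl⟩ := hq a
        -- For y in ker r, the lift t y lies in the image of A and equals i (q x); the sign cancels
        -- it.
        refine ⟨⟨(-x, y.1), ?_⟩, rfl⟩
        rw [LinearMap.mem_ker, hq'_apply, map_neg, map_neg, ha, neg_add_cancel]
    have hF : IsTotallyReflexive R C (Fin k → R) := IsTotallyReflexive.pi_fin hC k
    exact ⟨ModuleCat.of R (X × (Fin k → R)), q', hX.prod hF, hq',
      ih hjs (IsTotallyReflexive.left (isShortExact_ker_subtype hr) hF hD) hK⟩

/-- Pull a cover X → B back to A. The preimage of A is the kernel of the surjection X → D, hence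
totally reflexive, and it covers A with the same kernel as X → B; no induction is needed. -/
theorem left [IsNoetherianRing R] (h : IsShortExact i p)
    (hD : IsTotallyReflexive R C D) (hB : GCdimLE R C n B) : GCdimLE R C n A := by
  cases n with
  | zero => exact IsTotallyReflexive.left h hB hD
  | succ n =>
    obtain ⟨X, q, hX, hq, hK⟩ := hB
    have hY : IsTotallyReflexive R C (LinearMap.ker (p ∘ₗ q)) :=
      IsTotallyReflexive.left (isShortExact_ker_subtype (h.surjective.comp hq)) hX hD
    obtain ⟨w, hw⟩ := h.exists_lift (q ∘ₗ (LinearMap.ker (p ∘ₗ q)).subtype) fun y => y.2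
    have hle : LinearMap.ker q ≤ LinearMap.ker (p ∘ₗ q) := LinearMap.ker_le_ker_comp q p
    refine of_isShortExact (i := Submodule.inclusion hle) (p := w)
      ⟨Submodule.inclusion_injective hle, fun y => ⟨fun hy => ?_, ?_⟩, fun a => ?_⟩ hY hK
    · have hqy : q y.1 = 0 := by
        rw [← map_zero i, ← hy, hw]
        rfl
      exact ⟨⟨y.1, hqy⟩, rfl⟩
    · rintro ⟨x, rfl⟩
      exact h.injective (by rw [hw, map_zero]; exact x.2)
    · obtain ⟨x, hx⟩ := hq (i a)
      refine ⟨⟨x, ?_⟩, h.injective ?_⟩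
      · rw [LinearMap.mem_ker, LinearMap.comp_apply, hx, h.apply_apply]
      · exact (hw _).trans hx

/-- A Schanuel argument. The fibre product Z of B and X over D is an extension of B by ker q and
also of X by A. The bound passes from ker q up to Z by `mid`, then down to A by `left`. -/
theorem succ_iff [IsNoetherianRing R] (hC : IsSemidualizing R C) (h : IsShortExact i p)
    (hB : IsTotallyReflexive R C B) : GCdimLE R C (n + 1) D ↔ GCdimLE R C n A := by
  refine ⟨?_, of_isShortExact h hB⟩
  rintro ⟨X, q, hX, hq, hK⟩
  let Z := LinearMap.eqLocus (p ∘ₗ LinearMap.fst R B X) (q ∘ₗ LinearMap.snd R B X)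
  have hZ (z : B × X) : z ∈ Z ↔ p z.1 = q z.2 := Iff.rfl
  let j : LinearMap.ker q →ₗ[R] Z :=
    (LinearMap.inr R B X ∘ₗ (LinearMap.ker q).subtype).codRestrict Z fun x =>
      (hZ _).2 (by simp)
  let j' : A →ₗ[R] Z :=
    (LinearMap.inl R B X ∘ₗ i).codRestrict Z fun a => (hZ _).2 (by simp [h.apply_apply])
  have hj : IsShortExact j (LinearMap.fst R B X ∘ₗ Z.subtype) := by
    refine ⟨fun x y hxy => ?_, fun z => ⟨fun hz => ?_, ?_⟩, fun b => ?_⟩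
    · exact Subtype.ext (congrArg (fun z : Z => z.1.2) hxy)
    · obtain ⟨⟨b, x⟩, hbx⟩ := z
      obtain rfl : b = 0 := hz
      exact ⟨⟨x, by simpa using ((hZ _).1 hbx).symm⟩, rfl⟩
    · rintro ⟨x, rfl⟩
      rfl
    · obtain ⟨x, hx⟩ := hq (p b)
      exact ⟨⟨(b, x), hx.symm⟩, rfl⟩
  have hj' : IsShortExact j' (LinearMap.snd R B X ∘ₗ Z.subtype) := by
    refine ⟨fun x y hxy => ?_, fun z => ⟨fun hz => ?_, ?_⟩, fun x => ?_⟩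
    · exact h.injective (congrArg (fun z : Z => z.1.1) hxy)
    · obtain ⟨⟨b, x⟩, hbx⟩ := z
      obtain rfl : x = 0 := hz
      obtain ⟨a, rfl⟩ := (h.exact b).1 (by simpa using (hZ _).1 hbx)
      exact ⟨a, rfl⟩
    · rintro ⟨x, rfl⟩
      rfl
    · obtain ⟨b, hb⟩ := h.surjective (q x)
      exact ⟨⟨(b, x), hb⟩, rfl⟩
  exact left hj' hX (mid hC hj hB hK)

end GCdimLE

/-! ### Comparison of the recursive bound with resolutions. -/

/-- The truncation of a `G_C`-resolution of `M`, as a resolution of the kernel of its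
augmentation. -/
def GCResolution.kernel (res : GCResolution R C A) : GCResolution R C (LinearMap.ker res.ε) where
  X i := res.X (i + 1)
  d i := res.d (i + 1)
  ε := (res.d 0).codRestrict _ res.exact_zero.apply_apply_eq_zero
  totallyReflexive i := res.totallyReflexive (i + 1)
  surjective := fun x => by
    obtain ⟨y, hy⟩ := (res.exact_zero x.1).1 x.2
    exact ⟨y, Subtype.ext hy⟩
  exact_zero := fun x => Subtype.ext_iff.trans (res.exact_succ 0 x)
  exact_succ i := res.exact_succ (i + 1)

/-- The `G_C`-resolution obtained by prolonging a resolution of a kernel. -/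
def GCResolution.cons {X : ModuleCat.{u} R} (p : X →ₗ[R] A) (hX : IsTotallyReflexive R C X)
    (hp : Function.Surjective p) (res : GCResolution R C (LinearMap.ker p)) :
    GCResolution R C A where
  X i := Nat.casesOn i X res.X
  d i := Nat.casesOn i ((LinearMap.ker p).subtype ∘ₗ res.ε) res.d
  ε := p
  totallyReflexive i := Nat.casesOn i hX res.totallyReflexive
  surjective := hp
  exact_zero := fun x => by
    refine ⟨fun hx => ?_, ?_⟩
    · obtain ⟨y, hy⟩ := res.surjective ⟨x, hx⟩
      exact ⟨y, congrArg Subtype.val hy⟩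
    · rintro ⟨y, rfl⟩
      exact (res.ε y).2
  exact_succ i := Nat.casesOn i (fun x => Subtype.ext_iff.symm.trans (res.exact_zero x))
    res.exact_succ

theorem hasGCResolutionOfLength_iff (hC : IsSemidualizing R C) {n : ℕ} :
    HasGCResolutionOfLength R C A n ↔ GCdimLE R C n A := by
  induction n generalizing A with
  | zero =>
    constructor
    · rintro ⟨res, hres⟩
      have := hres 1 one_pos
      have hinj : Function.Injective res.ε := by
        rw [injective_iff_map_eq_zero]
        intro x hx
        obtain ⟨y, rfl⟩ := (res.exact_zero x).1 hx
        rw [Subsingleton.elim y 0, map_zero]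
      exact (res.totallyReflexive 0).of_equiv
        (LinearEquiv.ofBijective res.ε ⟨hinj, res.surjective⟩).symm
    · intro hA
      -- The kernel of the identity is zero, so it is resolved by zero modules.
      let res₀ : GCResolution R C (LinearMap.ker (LinearMap.id : A →ₗ[R] A)) :=
        { X := fun _ => ModuleCat.of R PUnit
          d := fun _ => 0
          ε := 0
          totallyReflexive := fun _ => IsTotallyReflexive.of_subsingleton hC
          surjective := fun x => ⟨0, Subtype.ext x.2.symm⟩
          exact_zero := fun x => ⟨fun _ => ⟨x, rfl⟩, fun _ => rfl⟩
          exact_succ := fun _ x => ⟨fun _ => ⟨x, rfl⟩, fun _ => rfl⟩ }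
      refine ⟨GCResolution.cons (X := ModuleCat.of R A) LinearMap.id hA
        Function.surjective_id res₀, fun i hi => ?_⟩
      obtain ⟨i, rfl⟩ := Nat.exists_eq_succ_of_ne_zero hi.ne'
      exact inferInstanceAs (Subsingleton PUnit)
  | succ n ih =>
    constructor
    · rintro ⟨res, hres⟩
      exact ⟨res.X 0, res.ε, res.totallyReflexive 0, res.surjective,
        ih.1 ⟨res.kernel, fun i hi => hres (i + 1) (Nat.succ_lt_succ hi)⟩⟩
    · rintro ⟨X, p, hX, hp, hK⟩
      obtain ⟨res, hres⟩ := ih.2 hK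
      refine ⟨GCResolution.cons p hX hp res, fun i hi => ?_⟩
      obtain ⟨i, rfl⟩ := Nat.exists_eq_succ_of_ne_zero (Nat.ne_zero_of_lt hi)
      exact hres i (Nat.lt_of_succ_lt_succ hi)

/-! ### Arithmetic of the dimension in ℕ∞. -/

theorem GCdim_le_iff (hC : IsSemidualizing R C) {n : ℕ} :
    GCdim R C A ≤ n ↔ GCdimLE R C n A := by
  rw [← hasGCResolutionOfLength_iff hC]
  refine ⟨fun h => ?_, fun h => iInf₂_le n h⟩
  -- Relaxing ≤ n to < n + 1 extracts a resolution of some length m ≤ n from the infimum; it also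
  -- counts as one of length n.
  obtain ⟨m, hm⟩ := iInf_lt_iff.1 (h.trans_lt (ENat.natCast_lt_natCast.2 n.lt_succ_self))
  obtain ⟨hm, hmn⟩ := iInf_lt_iff.1 hm
  obtain ⟨res, hres⟩ := hm
  exact ⟨res, fun i hi => hres i ((Nat.lt_succ_iff.1 (by exact_mod_cast hmn)).trans_lt hi)⟩

theorem ENat.le_of_forall_le_natCast {x y : ℕ∞} (h : ∀ n : ℕ, x ≤ n → y ≤ n) : y ≤ x := by
  induction x using ENat.recTopCoe with
  | top => exact le_top
  | coe n => exact h n le_rfl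

theorem GCdim_congr (hC : IsSemidualizing R C)
    (h : ∀ n, GCdimLE R C n A ↔ GCdimLE R C n B) : GCdim R C A = GCdim R C B :=
  le_antisymm
    (ENat.le_of_forall_le_natCast fun n => by simpa only [GCdim_le_iff hC] using (h n).2)
    (ENat.le_of_forall_le_natCast fun n => by simpa only [GCdim_le_iff hC] using (h n).1)

theorem GCdim_eq_of_equiv (hC : IsSemidualizing R C) (e : A ≃ₗ[R] B) :
    GCdim R C A = GCdim R C B :=
  GCdim_congr hC fun _ => ⟨fun h => h.of_equiv e.symm, fun h => h.of_equiv e⟩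

theorem GCdim_eq_of_isShortExact [IsNoetherianRing R] (hC : IsSemidualizing R C) {i : A →ₗ[R] B}
    {p : B →ₗ[R] D} (h : IsShortExact i p) (hD : IsTotallyReflexive R C D) :
    GCdim R C A = GCdim R C B :=
  GCdim_congr hC fun _ => ⟨GCdimLE.mid hC h hD, GCdimLE.left h hD⟩

theorem GCdim_eq_zero_iff (hC : IsSemidualizing R C) :
    GCdim R C A = 0 ↔ IsTotallyReflexive R C A := by
  rw [← nonpos_iff_eq_zero]
  exact GCdim_le_iff hC (n := 0)

/-- Dimension zero must be excluded: a totally reflexive D has a totally reflexive kernel, and the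
formula would read 0 = 1. Infinite values are allowed. -/
theorem GCdim_eq_add_one [IsNoetherianRing R] (hC : IsSemidualizing R C) {i : A →ₗ[R] B}
    {p : B →ₗ[R] D} (h : IsShortExact i p) (hB : IsTotallyReflexive R C B)
    (hD : GCdim R C D ≠ 0) : GCdim R C D = GCdim R C A + 1 := by
  have key (n : ℕ) : GCdim R C D ≤ (n + 1 : ℕ) ↔ GCdim R C A ≤ n := by
    rw [GCdim_le_iff hC, GCdim_le_iff hC, GCdimLE.succ_iff hC h hB]
  apply le_antisymm
  · cases hA : GCdim R C A using ENat.recTopCoe with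
    | top => simp
    | coe n => exact (key n).2 hA.le
  · cases hD' : GCdim R C D using ENat.recTopCoe with
    | top => exact le_top
    | coe n =>
      obtain _ | n := n
      · exact absurd hD' hD
      · exact add_le_add_left ((key n).1 hD'.le) 1

end

/-- Serves to embed Ext^1(M, C) into the transpose by comparing kernels of two maps out of L^†. -/
theorem LinearMap.exists_factor_of_ker_eq {R X Y Z : Type*} [CommRing R] [AddCommGroup X]
    [Module R X] [AddCommGroup Y] [Module R Y] [AddCommGroup Z] [Module R Z] {π : X →ₗ[R] Y}
    {θ : X →ₗ[R] Z} (hπ : Function.Surjective π) (h : LinearMap.ker π = LinearMap.ker θ) :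
    ∃ α : Y →ₗ[R] Z, Function.Injective α ∧ ∀ x, α (π x) = θ x := by
  let α : Y →ₗ[R] Z :=
    (LinearMap.ker π).liftQ θ h.le ∘ₗ (π.quotKerEquivOfSurjective hπ).symm.toLinearMap
  have hα (x) : α (π x) = θ x := by
    have : (π.quotKerEquivOfSurjective hπ).symm (π x) = Submodule.Quotient.mk x :=
      (LinearEquiv.symm_apply_eq _).2 rfl
    simp [α, this]
  refine ⟨α, (injective_iff_map_eq_zero α).2 fun y hy => ?_, hα⟩
  obtain ⟨x, rfl⟩ := hπ y
  rw [hα, ← LinearMap.mem_ker, ← h] at hy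
  exact hy

/-! ### Transposes, syzygies and Ext. -/

section

variable {R : Type u} [CommRing R] {C M P₁ P₀ : Type u} [AddCommGroup C] [Module R C]
  [AddCommGroup M] [Module R M] [AddCommGroup P₁] [Module R P₁] [AddCommGroup P₀] [Module R P₀]
  {f : P₁ →ₗ[R] P₀} {g : P₀ →ₗ[R] M}

namespace IsProjectivePresentation

variable (hfg : IsProjectivePresentation f g)
include hfg

theorem totallyReflexive_one [IsNoetherianRing R] (hC : IsSemidualizing R C) :
    IsTotallyReflexive R C P₁ :=
  have := hfg.finite_one
  have := hfg.projective_one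
  .of_projective hC

theorem totallyReflexive_zero [IsNoetherianRing R] (hC : IsSemidualizing R C) :
    IsTotallyReflexive R C P₀ :=
  have := hfg.finite_zero
  have := hfg.projective_zero
  .of_projective hC

omit hfg in
/-- The first map of a presentation, with values in the first syzygy. -/
def toSyzygy (hfg : IsProjectivePresentation f g) : P₁ →ₗ[R] LinearMap.ker g :=
  f.codRestrict _ hfg.exact.apply_apply_eq_zero

theorem toSyzygy_surjective : Function.Surjective hfg.toSyzygy := fun x => by
  obtain ⟨y, hy⟩ := (hfg.exact x.1).1 x.2
  exact ⟨y, Subtype.ext hy⟩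

theorem toSyzygy_apply_eq_zero {x : P₁} : hfg.toSyzygy x = 0 ↔ f x = 0 := Subtype.ext_iff

theorem isShortExact_syzygy : IsShortExact (LinearMap.ker g).subtype g :=
  isShortExact_ker_subtype hfg.surjective

/-- If a transpose of `M` is totally reflexive, then so is `M`. -/
theorem isTotallyReflexive_of_TrC [IsNoetherianRing R] (hC : IsSemidualizing R C)
    (h : IsTotallyReflexive R C (TrC C f)) : IsTotallyReflexive R C M := by
  have hP₁ := hfg.totallyReflexive_one hC
  have hP₀ := hfg.totallyReflexive_zero hC
  let K := LinearMap.range (LinearMap.lcomp R C f)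
  have s₂ : IsShortExact K.subtype K.mkQ :=
    ⟨Subtype.val_injective, LinearMap.exact_subtype_mkQ K, K.mkQ_surjective⟩
  have s₁ : IsShortExact (LinearMap.lcomp R C g) (LinearMap.lcomp R C f).rangeRestrict := by
    refine ⟨LinearMap.lcomp_injective_of_surjective _ hfg.surjective, fun φ => ?_,
      LinearMap.surjective_rangeRestrict _⟩
    exact Subtype.ext_iff.trans
      (LinearMap.exact_lcomp_of_exact_of_surjective C hfg.exact hfg.surjective φ)
  have hK : IsTotallyReflexive R C K := .left s₂ (hP₁.dual hC) h
  have hM : IsTotallyReflexive R C (M →ₗ[R] C) := .left s₁ (hP₀.dual hC) hK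
  -- These two vanishings keep both sequences exact after dualizing, so P₁^†† → P₀^†† → M^†† → 0 is
  -- exact. Comparison with P₁ → P₀ → M → 0 gives the biduality of M, and M ≅ M^†† inherits total
  -- reflexivity from M^†.
  have := h.ext_eq_zero 1 one_pos
  have := hK.ext_eq_zero 1 one_pos
  have hbij : Function.Bijective (biduality R C M) := by
    constructor
    · rw [injective_iff_map_eq_zero]
      intro m hm
      obtain ⟨x, rfl⟩ := hfg.surjective m
      obtain ⟨κ, hκ⟩ := (s₁.dual (C := C)).exact (biduality R C P₀ x) |>.1 hm
      obtain ⟨χ, rfl⟩ := (s₂.dual (C := C)).surjective κ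
      obtain ⟨y, rfl⟩ := hP₁.biduality_bijective.2 χ
      have hy : f y = x := hP₀.biduality_bijective.1 hκ
      rw [← hy, hfg.exact.apply_apply_eq_zero]
    · intro φ
      obtain ⟨ψ, rfl⟩ := (s₁.dual (C := C)).surjective φ
      obtain ⟨x, rfl⟩ := hP₀.biduality_bijective.2 ψ
      exact ⟨g x, rfl⟩
  exact (hM.dual hC).of_equiv (LinearEquiv.ofBijective _ hbij)

/-- If the first syzygy of `M` is totally reflexive, then `Ext^1_R(M, C)` and the transpose have
the same `G_C`-dimension. -/
theorem GCdim_ext_one_eq [IsNoetherianRing R] (hC : IsSemidualizing R C)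
    (hL : IsTotallyReflexive R C (LinearMap.ker g)) :
    GCdim R C (ModExt R M C 1) = GCdim R C (TrC C f) := by
  have hP₁ := hfg.totallyReflexive_one hC
  have := (hfg.totallyReflexive_zero hC).ext_eq_zero 1 one_pos
  have := hL.ext_eq_zero 1 one_pos
  have s₀ := hfg.isShortExact_syzygy
  have s₁ := isShortExact_ker_subtype hfg.toSyzygy_surjective
  have d₁ := s₁.dual (C := C)
  have hN : IsTotallyReflexive R C (LinearMap.ker hfg.toSyzygy) := .left s₁ hP₁ hL
  let K := LinearMap.range (LinearMap.lcomp R C f)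
  let θ : (LinearMap.ker g →ₗ[R] C) →ₗ[R] TrC C f := K.mkQ ∘ₗ LinearMap.lcomp R C hfg.toSyzygy
  have hker : LinearMap.ker (s₀.homConnecting C) = LinearMap.ker θ := by
    ext ψ
    rw [s₀.exact_homConnecting.linearMap_ker_eq]
    simp only [θ, LinearMap.mem_ker, LinearMap.comp_apply, Submodule.mkQ_apply,
      Submodule.Quotient.mk_eq_zero]
    -- Both kernels consist of the ψ that extend to P₀; restriction along the surjection P₁ → L
    -- loses nothing.
    refine exists_congr fun φ => ?_
    rw [← d₁.injective.eq_iff]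
    rfl
  obtain ⟨α, hα, hαθ⟩ := LinearMap.exists_factor_of_ker_eq s₀.homConnecting_surjective hker
  let β : TrC C f →ₗ[R] (LinearMap.ker hfg.toSyzygy →ₗ[R] C) :=
    K.liftQ (LinearMap.lcomp R C (LinearMap.ker hfg.toSyzygy).subtype) (by
      rintro _ ⟨φ, rfl⟩
      ext x
      have : f x.1 = 0 := hfg.toSyzygy_apply_eq_zero.1 x.2
      simp [this])
  have s : IsShortExact α β := by
    refine ⟨hα, fun z => ?_, fun ν => ?_⟩
    · obtain ⟨χ, rfl⟩ := K.mkQ_surjective z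
      refine ⟨fun hz => ?_, ?_⟩
      · obtain ⟨ψ, rfl⟩ := (d₁.exact χ).1 hz
        exact ⟨_, hαθ ψ⟩
      · rintro ⟨x, hx⟩
        obtain ⟨ψ, rfl⟩ := s₀.homConnecting_surjective x
        rw [← hx, hαθ]
        exact d₁.apply_apply ψ
    · obtain ⟨χ, rfl⟩ := d₁.surjective ν
      exact ⟨K.mkQ χ, rfl⟩
  exact GCdim_eq_of_isShortExact hC s (hN.dual hC)

/-- A projective presentation can be prolonged to one of the first syzygy. -/
theorem exists_syzygy_presentation [IsNoetherianRing R] :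
    ∃ (k : ℕ) (f₂ : (Fin k → R) →ₗ[R] P₁), IsProjectivePresentation f₂ hfg.toSyzygy := by
  have := hfg.finite_one
  obtain ⟨k, r, hr⟩ := Module.Finite.exists_fin' R (LinearMap.ker hfg.toSyzygy)
  refine ⟨k, (LinearMap.ker hfg.toSyzygy).subtype ∘ₗ r, inferInstance, this, inferInstance,
    hfg.projective_one, fun x => ⟨fun hx => ?_, ?_⟩, hfg.toSyzygy_surjective⟩
  · obtain ⟨y, hy⟩ := hr ⟨x, hx⟩
    exact ⟨y, congrArg Subtype.val hy⟩
  · rintro ⟨y, rfl⟩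
    exact (r y).2

/-- If `Ext^1_R(M, C) = 0`, then the transpose of `M` embeds into the dual of a projective module
with cokernel the transpose of the first syzygy. -/
theorem exists_isShortExact_TrC [Subsingleton (ModExt R M C 1)] {P₂ : Type u} [AddCommGroup P₂]
    [Module R P₂] {f₂ : P₂ →ₗ[R] P₁} (hf₂ : IsProjectivePresentation f₂ hfg.toSyzygy) :
    ∃ α : TrC C f →ₗ[R] (P₂ →ₗ[R] C),
      IsShortExact α (LinearMap.range (LinearMap.lcomp R C f₂)).mkQ := by
  have hle : LinearMap.range (LinearMap.lcomp R C f) ≤ LinearMap.ker (LinearMap.lcomp R C f₂) := by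
    rintro _ ⟨φ, rfl⟩
    ext x
    have : f (f₂ x) = 0 := hfg.toSyzygy_apply_eq_zero.1 (hf₂.exact.apply_apply_eq_zero x)
    simp [this]
  let α : TrC C f →ₗ[R] (P₂ →ₗ[R] C) := Submodule.liftQ _ (LinearMap.lcomp R C f₂) hle
  refine ⟨α, (injective_iff_map_eq_zero α).2 fun z hz => ?_, fun y => ?_,
    Submodule.mkQ_surjective _⟩
  · obtain ⟨χ, rfl⟩ := Submodule.mkQ_surjective _ z
    obtain ⟨ψ, rfl⟩ :=
      (LinearMap.exact_lcomp_of_exact_of_surjective C hf₂.exact hf₂.surjective χ).1 hz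
    -- Here Ext^1(M, C) = 0 enters: the functional ψ on the syzygy extends to P₀.
    obtain ⟨φ, rfl⟩ := hfg.isShortExact_syzygy.lcomp_surjective ψ
    exact (Submodule.Quotient.mk_eq_zero _).2 ⟨φ, rfl⟩
  · refine (Submodule.Quotient.mk_eq_zero _).trans ⟨?_, ?_⟩
    · rintro ⟨χ, rfl⟩
      exact ⟨Submodule.Quotient.mk χ, rfl⟩
    · rintro ⟨z, rfl⟩
      obtain ⟨χ, rfl⟩ := Submodule.mkQ_surjective _ z
      exact ⟨χ, rfl⟩

end IsProjectivePresentation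

end

/-- Perfection is replaced by vanishing of Ext in degrees 1 to n, a condition that passes to the
first syzygy with n lowered by one. The presentation is generalized too, since the syzygy comes with
its own. -/
theorem GCdim_add_GCdim_TrC {R : Type u} [CommRing R] [IsNoetherianRing R] {C : Type u}
    [AddCommGroup C] [Module R C] (hC : IsSemidualizing R C) (n : ℕ)
    {M : Type u} [AddCommGroup M] [Module R M] (hn : GCdim R C M = (n + 1 : ℕ))
    (hext : ∀ i, 0 < i → i < n + 1 → Subsingleton (ModExt R M C i))
    {P₁ P₀ : Type u} [AddCommGroup P₁] [Module R P₁] [AddCommGroup P₀] [Module R P₀]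
    {f : P₁ →ₗ[R] P₀} {g : P₀ →ₗ[R] M} (hfg : IsProjectivePresentation f g) :
    GCdim R C M + GCdim R C (TrC C f) = GCdim R C (ModExt R M C (n + 1)) + 1 := by
  induction n generalizing M P₁ P₀ with
  | zero =>
    have hL : IsTotallyReflexive R C (LinearMap.ker g) :=
      (GCdimLE.succ_iff hC hfg.isShortExact_syzygy (hfg.totallyReflexive_zero hC)).1
        ((GCdim_le_iff hC).1 hn.le)
    rw [hn, hfg.GCdim_ext_one_eq hC hL, add_comm]
    rfl
  | succ n ih =>
    have hP₀ := hfg.totallyReflexive_zero hC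
    have s₀ := hfg.isShortExact_syzygy
    have hM := GCdim_eq_add_one hC s₀ hP₀ (by rw [hn]; simp)
    have hn' : GCdim R C (LinearMap.ker g) = (n + 1 : ℕ) := by
      rw [hn, Nat.cast_succ] at hM
      exact (WithTop.add_right_cancel ENat.one_ne_top hM).symm
    obtain ⟨k, f₂, hf₂⟩ := hfg.exists_syzygy_presentation
    have := hext 1 one_pos (Nat.succ_lt_succ n.succ_pos)
    obtain ⟨α, s⟩ := hfg.exists_isShortExact_TrC (C := C) hf₂
    have hTr := GCdim_eq_add_one hC s ((hf₂.totallyReflexive_one hC).dual hC) (by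
      intro h0
      have h1 := hf₂.isTotallyReflexive_of_TrC hC ((GCdim_eq_zero_iff hC).1 h0)
      rw [(GCdim_eq_zero_iff hC).2 h1] at hn'
      exact n.succ_ne_zero (by exact_mod_cast hn'.symm))
    have h := ih hn' (fun i hi hin => by
      have := hP₀.ext_eq_zero i hi
      have := hext (i + 1) i.succ_pos (Nat.succ_lt_succ hin)
      exact s₀.subsingleton_ext_left) hf₂
    have := hP₀.ext_eq_zero (n + 1) n.succ_pos
    have := hP₀.ext_eq_zero (n + 2) (n + 1).succ_pos
    -- Dimension shifting along P₀ identifies Ext^{n+1} of the syzygy with Ext^{n+2}(M, C); the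
    -- extra 1 moves from the dimension of M to that of the transpose.
    rw [← GCdim_eq_of_equiv hC (LinearEquiv.ofBijective _ (s₀.connecting_bijective (n := n + 1))),
      ← h, hM, hTr, add_assoc, add_comm 1]

theorem mainTheorem1 {R : Type u} [CommRing R] [IsNoetherianRing R] (hR : IsSemiperfectRing R)
    {C : Type u} [AddCommGroup C] [Module R C] (hC : IsSemidualizing R C)
    {M : Type u} [AddCommGroup M] [Module R M] (hM : IsReducedGCPerfect R C M)
    (n : ℕ) (hn : GCdim R C M = n)
    {P₁ P₀ : Type u} [AddCommGroup P₁] [Module R P₁] [AddCommGroup P₀] [Module R P₀]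
    (f : P₁ →ₗ[R] P₀) (g : P₀ →ₗ[R] M) (hfg : IsProjectivePresentation f g) :
    GCdim R C M + GCdim R C (TrC C f) = GCdim R C (ModExt R M C n) + 1 := by
  have hgrade : reducedGrade R C M = n := hM.reducedGrade_eq.trans hn
  have hlt (i : ℕ) (hi : 0 < i) (hin : i < n) : Subsingleton (ModExt R M C i) := by
    by_contra h
    have : reducedGrade R C M ≤ i := iInf₂_le i ⟨hi, not_subsingleton_iff_nontrivial.1 h⟩
    rw [hgrade] at this
    exact absurd (ENat.natCast_le_natCast.1 this) hin.not_ge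
  -- The reduced grade only sees positive degrees, so n = 0 cannot occur.
  have hpos : 1 ≤ reducedGrade R C M :=
    le_iInf₂ fun i hi => by exact_mod_cast hi.1
  rw [hgrade] at hpos
  obtain ⟨n, rfl⟩ := Nat.exists_eq_succ_of_ne_zero
    (Nat.one_le_iff_ne_zero.1 (by exact_mod_cast hpos))
  exact GCdim_add_GCdim_TrC hC n hn hlt hfg
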